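/- Let $n>2$ be a finite number. For a set $U$ let $\wp({}^nU)$ be the set of all subsets of ${}^nU$ (the set of $n$-tuples over $U$). Consider on it the Boolean operations $\cup,\cap,\sim,\emptyset,{}^nU$ together with, for $i,j<n$, $$C_iX=\{s:\ s(i|a)\in X\text{ for some }a\in U\},\qquad D_{ij}=\{s:\ s_i=s_j\},\qquad S^i_jX=\{s:\ s(i|s_j)\in X\},$$ where $s(i|a)$ is $s$ with its $i$-th coordinate replaced by $a$. Let $\mathsf{RCA}_n$ (the representable cylindric algebras of dimension $n$) be the class of all algebras isomorphic to a subalgebra of a direct product of algebras $\langle\wp({}^nU),\cup,\cap,\sim,\emptyset,{}^nU,C_i,D_{ij}\rangle_{i,j<n}$, and let $\mathsf{RSC}_n$ (the representable Pinter substitution algebras of dimension $n$) be the class of all algebras isomorphic to a subalgebra of a direct product of algebras $\langle\wp({}^nU),\cup,\cap,\sim,\emptyset,{}^nU,C_i,S^i_j\rangle_{i,j<n}$. For a class $K$ of similar algebras and a cardinal $\beta>0$, let $\mathfrak{Fr}_\beta K$ be the free algebra of $K$ on $\beta$ generators, i.e. the algebra of terms in $\beta$ variables modulo the equations valid in $K$.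 A subset $Y$ of an algebra $\mathfrak A$ is an irredundant generating set if $Y$ generates $\mathfrak A$ and no proper subset of $Y$ does; $Y$ generates $\mathfrak A$ freely (over $K$) if $Y$ generates $\mathfrak A$ and every map from $Y$ into a member $\mathfrak B$ of $K$ extends to a homomorphism $\mathfrak A\to\mathfrak B$. **Theorem.** For every finite $n>2$ and every cardinal $\beta>0$ (finite or infinite), the algebra $\mathfrak{Fr}_\beta\mathsf{RCA}_n$ has an irredundant generating set with exactly $\beta$ elements which does not generate it freely over $\mathsf{RCA}_n$. Likewise, $\mathfrak{Fr}_\beta\mathsf{RSC}_n$ has an irredundant generating set with exactly $\beta$ elements which does not generate it freely over $\mathsf{RSC}_n$. -/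

import Mathlib

universe u

namespace CylindricLike


/-! ### Free algebras over a class of algebras -/

/-- A class of algebras (with carriers in `Type u`) of a given signature. -/
abbrev AlgClass (L : FirstOrder.Language.{0, 0}) : Type (u + 1) :=
  ∀ (A : Type u) [L.Structure A], Prop

section Free

variable {L : FirstOrder.Language.{0, 0}}

/-- Two terms are identified when the corresponding equation is valid in every member of `K`. -/
def identities (K : AlgClass.{u} L) (X : Type u) : Setoid (L.Term X) where
  r s t := ∀ (A : Type u) [L.Structure A], K A → ∀ v : X → A, s.realize v = t.realize v
  iseqv :=
    { refl := fun _ _ _ _ _ => rfl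
      symm := fun h A _ hA v => (h A hA v).symm
      trans := fun h₁ h₂ A _ hA v => (h₁ A hA v).trans (h₂ A hA v) }

/-- The absolutely free term algebra on `X`, together with the fact that the identities of `K`
form a congruence on it. (All signatures used below have no relation symbols.) -/
instance termPrestructure (K : AlgClass.{u} L) (X : Type u) :
    L.Prestructure (identities K X) where
  toStructure :=
    { funMap := fun f x => FirstOrder.Language.Term.func f x
      RelMap := fun _ _ => False }
  fun_equiv := by
    intro k f x y h A _ hA v
    change (FirstOrder.Language.Term.func f x).realize v = (FirstOrder.Language.Term.func f y).realize v
    simp only [FirstOrder.Language.Term.realize_func]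
    congr 1
    funext i
    exact h i A hA v
  rel_equiv := by
    intro k r x y _
    rfl

/-- The free algebra of the class `K` on the generators `X`: terms modulo the identities
of `K`. -/
def FreeAlg (K : AlgClass.{u} L) (X : Type u) : Type u :=
  Quotient (identities K X)

instance (K : AlgClass.{u} L) (X : Type u) : L.Structure (FreeAlg K X) :=
  FirstOrder.Language.quotientStructure (s := identities K X)

/-- `Fr K β` is the `β`-generated free algebra of the class `K`. -/
abbrev Fr (K : AlgClass.{u} L) (β : Cardinal.{u}) : Type u :=
  FreeAlg K β.out

variable (L) in
/-- `Y` generates `A`: the least subalgebra containing `Y` is `A`. -/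
def Generates {A : Type u} [L.Structure A] (Y : Set A) : Prop :=
  FirstOrder.Language.Substructure.closure L Y = ⊤

variable (L) in
/-- `Y` is an irredundant generating set: it generates, but none of its proper subsets does. -/
def IrredundantlyGenerates {A : Type u} [L.Structure A] (Y : Set A) : Prop :=
  Generates L Y ∧ ∀ Z : Set A, Z ⊂ Y → ¬ Generates L Z

/-- `Y` freely generates `A` over `K`: it generates `A`, and every map of `Y` into a
member of `K` extends to a homomorphism on `A`. -/
def FreelyGenerates (K : AlgClass.{u} L) {A : Type u} [L.Structure A] (Y : Set A) : Prop :=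
  Generates L Y ∧
    ∀ (B : Type u) [L.Structure B], K B →
      ∀ f : Y → B, ∃ g : L.Hom A B, ∀ y : Y, g y = f y

end Free

/-! ### Representable cylindric algebras -/

/-- The operation symbols of cylindric algebras of dimension `n`, sorted by arity. -/
inductive CAFunc (n : ℕ) : ℕ → Type
  | zero : CAFunc n 0
  | one : CAFunc n 0
  | diag (i j : Fin n) : CAFunc n 0
  | compl : CAFunc n 1
  | cyl (i : Fin n) : CAFunc n 1
  | sup : CAFunc n 2
  | inf : CAFunc n 2

/-- The signature of cylindric algebras of dimension `n`. -/
def langCA (n : ℕ) : FirstOrder.Language.{0, 0} := ⟨CAFunc n, fun _ => Empty⟩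

/-- The `i`-th cylindrification on subsets of `ⁿU`. -/
def cylindrify {n : ℕ} {U : Type u} (i : Fin n) (X : Set (Fin n → U)) : Set (Fin n → U) :=
  {s | ∃ a : U, Function.update s i a ∈ X}

/-- The substitution operation on subsets of `ⁿU`: replace the `i`-th coordinate by the
`j`-th one. -/
def substitute {n : ℕ} {U : Type u} (i j : Fin n) (X : Set (Fin n → U)) : Set (Fin n → U) :=
  {s | Function.update s i (s j) ∈ X}

/-- The full cylindric set algebra of dimension `n` with base `U`. -/
instance fullCs (n : ℕ) (U : Type u) : (langCA n).Structure (Set (Fin n → U)) where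
  funMap := fun {_} f =>
    match f with
    | CAFunc.zero => fun _ => ∅
    | CAFunc.one => fun _ => Set.univ
    | CAFunc.diag i j => fun _ => {s | s i = s j}
    | CAFunc.compl => fun x => (x 0)ᶜ
    | CAFunc.cyl i => fun x => cylindrify i (x 0)
    | CAFunc.sup => fun x => x 0 ∪ x 1
    | CAFunc.inf => fun x => x 0 ∩ x 1
  RelMap := fun r => nomatch r

/-- `RCA n`: the algebras isomorphic to a subalgebra of a direct product of full cylindric set
algebras. An embedding into a direct product is given as a jointly injective family of
homomorphisms into the factors. -/
def RCA (n : ℕ) : AlgClass.{u} (langCA n) := fun A _ =>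
  ∃ (I : Type u) (U : I → Type u) (h : ∀ i, (langCA n).Hom A (Set (Fin n → U i))),
    Function.Injective fun (a : A) (i : I) => h i a

/-! ### Representable substitution algebras in the sense of Pinter -/

/-- The operation symbols of Pinter's substitution algebras of dimension `n`, sorted by
arity. -/
inductive SCFunc (n : ℕ) : ℕ → Type
  | zero : SCFunc n 0
  | one : SCFunc n 0
  | compl : SCFunc n 1
  | cyl (i : Fin n) : SCFunc n 1
  | subst (i j : Fin n) : SCFunc n 1
  | sup : SCFunc n 2
  | inf : SCFunc n 2

/-- The signature of Pinter's substitution algebras of dimension `n`. -/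
def langSC (n : ℕ) : FirstOrder.Language.{0, 0} := ⟨SCFunc n, fun _ => Empty⟩

/-- The full substitution set algebra of dimension `n` with base `U`. -/
instance fullSubstAlg (n : ℕ) (U : Type u) : (langSC n).Structure (Set (Fin n → U)) where
  funMap := fun {_} f =>
    match f with
    | SCFunc.zero => fun _ => ∅
    | SCFunc.one => fun _ => Set.univ
    | SCFunc.compl => fun x => (x 0)ᶜ
    | SCFunc.cyl i => fun x => cylindrify i (x 0)
    | SCFunc.subst i j => fun x => substitute i j (x 0)
    | SCFunc.sup => fun x => x 0 ∪ x 1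
    | SCFunc.inf => fun x => x 0 ∩ x 1
  RelMap := fun r => nomatch r

/-- `RSC n`: the algebras isomorphic to a subalgebra of a direct product of full substitution
set algebras. -/
def RSC (n : ℕ) : AlgClass.{u} (langSC n) := fun A _ =>
  ∃ (I : Type u) (U : I → Type u) (h : ∀ i, (langSC n).Hom A (Set (Fin n → U i))),
    Function.Injective fun (a : A) (i : I) => h i a

end CylindricLike

/-!
Over any class `K`, suppose that unary terms `σ`, `τ` satisfy the identity `σ(τ(x)) = x` in `K`,
and that `τ` is not surjective on some `B ∈ K`. Replacing one free generator `x₀` by `τ(x₀)` still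
gives a generating set, since `x₀ = σ(τ(x₀))`. It is irredundant because, `τ` being injective but
not surjective on `B`, homomorphisms into `B` tell each new generator from the others; and it is
not free, because `τ(x₀)` cannot be sent outside the range of `τ` on `B`.

For algebras of `n`-ary relations with `n > 2`, a relation can code a binary relation `S` together
with a set `A`. The term `τ` replaces `A` by its image `S[A]`, provided that `A = S˘[S[A]]` and
`S ; S ; S˘ = S`, where `S˘` is the converse of `S`. These conditions only need three variables
and no equality; they pass from `A` to `S[A]`, and they make `A` recoverable from `S[A]` as
`S˘[S[A]]`. When `S` is the successor relation on `ℕ` and `A = {0}`, the set `A` is not an image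
under `S`, so `τ` is not surjective.
-/

namespace CylindricLike

open FirstOrder FirstOrder.Language Function
open scoped SetRel Cardinal

/-! ### Irredundant generating sets that are not free -/

section TermOp

variable {L : FirstOrder.Language.{0, 0}} {A B : Type u} [L.Structure A] [L.Structure B]

/-- The unary operation on an algebra that is given by a term in one variable. -/
def termOp (τ : L.Term Unit) (a : A) : A := τ.realize fun _ => a

theorem map_termOp (f : L.Hom A B) (τ : L.Term Unit) (a : A) :
    f (termOp τ a) = termOp τ (f a) :=
  (HomClass.realize_term f).symm

theorem leftInverse_termOp_iff {σ τ : L.Term Unit} :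
    LeftInverse (termOp σ : A → A) (termOp τ) ↔
      ∀ v : Unit → A, (σ.subst fun _ => τ).realize v = (Term.var () : L.Term Unit).realize v := by
  simp only [Term.realize_subst, Term.realize_var]
  exact ⟨fun h v => h (v ()), fun h a => h fun _ => a⟩

end TermOp

section FreeAlg

variable {L : FirstOrder.Language.{0, 0}} {K : AlgClass.{u} L} {X : Type u}

namespace FreeAlg

/-- The generator of the free algebra that belongs to a variable. -/
def of (K : AlgClass.{u} L) (x : X) : FreeAlg K X := Quotient.mk (identities K X) (Term.var x)

theorem realize_of (t : L.Term X) : t.realize (of K) = Quotient.mk (identities K X) t := by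
  refine (Term.realize_quotient_mk' (identities K X) t Term.var).trans ?_
  congr 1
  induction t with
  | var => rfl
  | func f ts ih => exact congrArg (Term.func f) (funext ih)

theorem generates_range_of : Generates L (Set.range (of K : X → FreeAlg K X)) := by
  refine eq_top_iff.2 fun a _ => ?_
  induction a using Quotient.inductionOn with
  | _ t =>
    rw [← realize_of]
    exact t.realize_mem _ fun x => Substructure.subset_closure ⟨x, rfl⟩

theorem realize_eq_realize {α : Type*} {s t : L.Term α}
    (h : ∀ (A : Type u) [L.Structure A], K A → ∀ v : α → A, s.realize v = t.realize v)
    (v : α → FreeAlg K X) : s.realize v = t.realize v := by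
  obtain ⟨w, rfl⟩ : ∃ w : α → L.Term X, v = fun a => (w a).realize (of K) :=
    ⟨fun a => (v a).out, funext fun a => by rw [realize_of]; exact (Quotient.out_eq _).symm⟩
  rw [← Term.realize_subst, ← Term.realize_subst, realize_of, realize_of]
  exact Quotient.sound fun A _ hA v => by simpa only [Term.realize_subst] using h A hA _

variable {B : Type u} [L.Structure B]

/-- The homomorphism from the free algebra to a member of the class that is induced by a
valuation of the variables. -/
def lift (hB : K B) (v : X → B) : L.Hom (FreeAlg K X) B where
  toFun := Quotient.lift (fun t : L.Term X => t.realize v)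
    fun t₁ t₂ (h : identities K X t₁ t₂) => h B hB v
  map_fun' := by
    intro k f x
    induction x using Quotient.induction_on_pi with
    | _ x =>
      exact congrArg (Quotient.lift (fun t : L.Term X => t.realize v)
        fun t₁ t₂ (h : identities K X t₁ t₂) => h B hB v)
        (funMap_quotient_mk' (identities K X) f x)
  map_rel' := by
    intro k r x
    induction x using Quotient.induction_on_pi with
    | _ x => exact fun h => ((relMap_quotient_mk' (identities K X) r x).1 h).elim

@[simp]
theorem lift_of (hB : K B) (v : X → B) (x : X) : lift hB v (of K x) = v x := rfl

end FreeAlg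

variable (L) in
/-- Every member `y z` of the family can be moved independently of the others by homomorphisms
into `B`: two of them differ at `y z` and agree on the rest of the family. -/
def HomSeparated {A : Type u} [L.Structure A] (B : Type u) [L.Structure B] (y : X → A) : Prop :=
  ∀ z, ∃ f g : L.Hom A B, (∀ x ≠ z, f (y x) = g (y x)) ∧ f (y z) ≠ g (y z)

section Separated

variable {A B : Type u} [L.Structure A] [L.Structure B] {y : X → A}

theorem HomSeparated.injective (h : HomSeparated L B y) : Injective y := by
  intro x z hxz
  by_contra hne
  obtain ⟨f, g, hfg, hz⟩ := h z
  exact hz (hxz ▸ hfg x hne)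

theorem HomSeparated.irredundantlyGenerates (h : HomSeparated L B y)
    (hy : Generates L (Set.range y)) : IrredundantlyGenerates L (Set.range y) := by
  refine ⟨hy, fun Z hZ hgen => ?_⟩
  obtain ⟨hZy, _, ⟨z, rfl⟩, hzZ⟩ := Set.ssubset_iff_exists.1 hZ
  obtain ⟨f, g, hfg, hz⟩ := h z
  have eqOn_Z : Set.EqOn f g Z := fun a ha => by
    obtain ⟨x, rfl⟩ := hZy ha
    exact hfg x fun hxz => hzZ (hxz ▸ ha)
  exact hz (DFunLike.congr_fun (Hom.eq_of_eqOn_dense hgen eqOn_Z) _)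

theorem not_freelyGenerates_of_termOp_mem (hB : K B) {τ : L.Term Unit}
    (hτ : ¬ Surjective (termOp τ : B → B)) {Y : Set A} {a : A} (ha : termOp τ a ∈ Y) :
    ¬ FreelyGenerates K Y := by
  rintro ⟨-, hfree⟩
  obtain ⟨b, hb⟩ := not_forall.1 hτ
  obtain ⟨g, hg⟩ := hfree B hB fun _ => b
  exact hb ⟨g a, (map_termOp g τ a).symm.trans (hg ⟨_, ha⟩)⟩

end Separated

open scoped Classical in
/-- The free generators, with the generator of `x₀` replaced by its image under `τ`. -/
noncomputable def replaceGenerator (K : AlgClass.{u} L) (τ : L.Term Unit) (x₀ : X) :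
    X → FreeAlg K X :=
  update (FreeAlg.of K) x₀ (termOp τ (FreeAlg.of K x₀))

variable {σ τ : L.Term Unit} {x₀ : X} {B : Type u} [L.Structure B]

theorem replaceGenerator_self : replaceGenerator K τ x₀ x₀ = termOp τ (FreeAlg.of K x₀) := by
  classical exact update_self ..

theorem replaceGenerator_of_ne {x : X} (hx : x ≠ x₀) :
    replaceGenerator K τ x₀ x = FreeAlg.of K x := by
  classical exact update_of_ne hx ..

theorem generates_range_replaceGenerator
    (hστ : ∀ (A : Type u) [L.Structure A], K A → LeftInverse (termOp σ : A → A) (termOp τ)) :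
    Generates L (Set.range (replaceGenerator K τ x₀)) := by
  have recover : termOp σ (replaceGenerator K τ x₀ x₀) = FreeAlg.of K x₀ := by
    rw [replaceGenerator_self]
    refine leftInverse_termOp_iff.2 (fun v => ?_) _
    exact FreeAlg.realize_eq_realize (fun A _ hA => leftInverse_termOp_iff.1 (hστ A hA)) v
  rw [Generates, ← top_le_iff, ← FreeAlg.generates_range_of (K := K) (X := X),
    Substructure.closure_le]
  rintro _ ⟨x, rfl⟩
  by_cases hx : x = x₀
  · rw [hx, ← recover]
    exact σ.realize_mem _ fun _ => Substructure.subset_closure ⟨x₀, rfl⟩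
  · exact Substructure.subset_closure ⟨x, replaceGenerator_of_ne hx⟩

theorem homSeparated_replaceGenerator (hB : K B) (hinj : Injective (termOp τ : B → B))
    (hsurj : ¬ Surjective (termOp τ : B → B)) :
    HomSeparated L B (replaceGenerator K τ x₀) := by
  classical
  obtain ⟨b, hb⟩ := not_forall.1 hsurj
  have ne_b (a : B) : termOp τ a ≠ b := fun h => hb ⟨a, h⟩
  intro z
  refine ⟨FreeAlg.lift hB fun _ => b, FreeAlg.lift hB (update (fun _ => b) z (termOp τ b)),
    fun x hxz => ?_, ?_⟩
  · by_cases hx : x = x₀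
    · subst hx
      simp only [replaceGenerator_self, map_termOp, FreeAlg.lift_of, update_of_ne hxz]
    · simp only [replaceGenerator_of_ne hx, FreeAlg.lift_of, update_of_ne hxz]
  · by_cases hz : z = x₀
    · subst hz
      simp only [replaceGenerator_self, map_termOp, FreeAlg.lift_of, update_self]
      exact hinj.ne (ne_b b).symm
    · simp only [replaceGenerator_of_ne hz, FreeAlg.lift_of, update_self]
      exact (ne_b b).symm

theorem exists_irredundantlyGenerates_not_freelyGenerates [Nonempty X]
    (hστ : ∀ (A : Type u) [L.Structure A], K A → LeftInverse (termOp σ : A → A) (termOp τ))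
    (hB : K B) (hτ : ¬ Surjective (termOp τ : B → B)) :
    ∃ Y : Set (FreeAlg K X), #Y = #X ∧ IrredundantlyGenerates L Y ∧ ¬ FreelyGenerates K Y := by
  obtain ⟨x₀⟩ := ‹Nonempty X›
  have separated : HomSeparated L B (replaceGenerator K τ x₀) :=
    homSeparated_replaceGenerator hB (hστ B hB).injective hτ
  exact ⟨Set.range (replaceGenerator K τ x₀), Cardinal.mk_range_eq _ separated.injective,
    separated.irredundantlyGenerates (generates_range_replaceGenerator hστ),
    not_freelyGenerates_of_termOp_mem hB hτ ⟨x₀, replaceGenerator_self⟩⟩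

end FreeAlg

section SP

variable {L : FirstOrder.Language.{0, 0}} {ι : Type*} {F : ι → Type u} [∀ i, L.Structure (F i)]

variable (L F) in
/-- The algebras isomorphic to a subalgebra of a direct product of members of the family `F`,
the embedding being given by its components. `RCA n` and `RSC n` are, by definition, of this
form. -/
def SP : AlgClass.{u} L := fun A _ =>
  ∃ (I : Type u) (k : I → ι) (h : ∀ i, L.Hom A (F (k i))), Injective fun (a : A) (i : I) => h i a

variable (L F) in
theorem SP_self (i : ι) : SP L F (F i) :=
  ⟨PUnit, fun _ => i, fun _ => Hom.id L _, fun _ _ h => congrFun h ⟨⟩⟩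

theorem SP.realize_eq_realize {A : Type u} [L.Structure A] (hA : SP L F A) {α : Type*}
    {s t : L.Term α} (h : ∀ i (v : α → F i), s.realize v = t.realize v) (v : α → A) :
    s.realize v = t.realize v := by
  obtain ⟨I, k, f, hf⟩ := hA
  refine hf (funext fun i => ?_)
  simp only [← HomClass.realize_term, h]

end SP

/-! ### Definability in algebras of relations -/

section Definable

variable {n : ℕ}

/-- Uniform definability of a property of `n`-tuples, over an arbitrary base `U` with one `n`-ary
relation `R`, by a formula in `n` variables without equality in which variables may be substituted
for each other. In terms of algebras of relations, this is definability by a term in the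
operations of substitution algebras. -/
inductive TermDefinable :
    ((U : Type u) → Set (Fin n → U) → (Fin n → U) → Prop) → Prop
  | mem : TermDefinable fun _ R s => s ∈ R
  | not {φ} : TermDefinable φ → TermDefinable fun U R s => ¬ φ U R s
  | and {φ ψ} : TermDefinable φ → TermDefinable ψ → TermDefinable fun U R s => φ U R s ∧ ψ U R s
  | exists_update {φ} (i : Fin n) : TermDefinable φ →
      TermDefinable fun U R s => ∃ a, φ U R (update s i a)
  | subst {φ} (i j : Fin n) : TermDefinable φ →
      TermDefinable fun U R s => φ U R (update s i (s j))

/-- Every definable property of tuples is given, on all full set algebras, by a term of the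
signature `L`. -/
def ExpressesDefinable (L : FirstOrder.Language.{0, 0}) (n : ℕ)
    [∀ U : Type u, L.Structure (Set (Fin n → U))] : Prop :=
  ∀ φ : (U : Type u) → Set (Fin n → U) → (Fin n → U) → Prop, TermDefinable φ →
    ∃ t : L.Term Unit, ∀ (U : Type u) (R : Set (Fin n → U)), termOp t R = {s | φ U R s}

theorem expressesDefinable_of_functions {L : FirstOrder.Language.{0, 0}}
    [∀ U : Type u, L.Structure (Set (Fin n → U))]
    (compl : L.Functions 1) (inf : L.Functions 2) (cyl : Fin n → L.Functions 1)
    (hcompl : ∀ (U : Type u) (x : Fin 1 → Set (Fin n → U)), Structure.funMap compl x = (x 0)ᶜ)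
    (hinf : ∀ (U : Type u) (x : Fin 2 → Set (Fin n → U)), Structure.funMap inf x = x 0 ∩ x 1)
    (hcyl : ∀ i (U : Type u) (x : Fin 1 → Set (Fin n → U)),
      Structure.funMap (cyl i) x = cylindrify i (x 0))
    (hsubst : ∀ i j (t : L.Term Unit), ∃ t' : L.Term Unit, ∀ (U : Type u) (R : Set (Fin n → U)),
      termOp t' R = substitute i j (termOp t R)) :
    ExpressesDefinable.{u} L n := by
  intro _ hφ
  induction hφ with
  | mem => exact ⟨Term.var (), fun _ _ => rfl⟩
  | not _ ih =>
    obtain ⟨t, ht⟩ := ih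
    exact ⟨compl.apply₁ t, fun U R => (hcompl U _).trans (congrArg (·ᶜ) (ht U R))⟩
  | and _ _ ih₁ ih₂ =>
    obtain ⟨t₁, ht₁⟩ := ih₁
    obtain ⟨t₂, ht₂⟩ := ih₂
    exact ⟨inf.apply₂ t₁ t₂,
      fun U R => (hinf U _).trans (congrArg₂ (· ∩ ·) (ht₁ U R) (ht₂ U R))⟩
  | exists_update i _ ih =>
    obtain ⟨t, ht⟩ := ih
    exact ⟨(cyl i).apply₁ t, fun U R => (hcyl i U _).trans (congrArg (cylindrify i) (ht U R))⟩
  | subst i j _ ih =>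
    obtain ⟨t, ht⟩ := ih
    obtain ⟨t', ht'⟩ := hsubst i j t
    exact ⟨t', fun U R => (ht' U R).trans (congrArg (substitute i j) (ht U R))⟩

theorem expressesDefinable_langSC (n : ℕ) : ExpressesDefinable.{u} (langSC n) n :=
  expressesDefinable_of_functions (L := langSC n) SCFunc.compl SCFunc.inf SCFunc.cyl
    (fun _ _ => rfl) (fun _ _ => rfl) (fun _ _ _ => rfl) fun i j t =>
      ⟨Functions.apply₁ (L := langSC n) (SCFunc.subst i j) t, fun _ _ => rfl⟩

theorem substitute_self {U : Type u} (i : Fin n) (X : Set (Fin n → U)) :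
    substitute i i X = X := by
  ext s
  simp [substitute]

theorem substitute_eq_cylindrify {U : Type u} {i j : Fin n} (hij : i ≠ j)
    (X : Set (Fin n → U)) : substitute i j X = cylindrify i ({s | s i = s j} ∩ X) := by
  ext s
  simp [substitute, cylindrify, update_of_ne hij.symm]

theorem expressesDefinable_langCA (n : ℕ) : ExpressesDefinable.{u} (langCA n) n := by
  refine expressesDefinable_of_functions (L := langCA n) CAFunc.compl CAFunc.inf CAFunc.cyl
    (fun _ _ => rfl) (fun _ _ => rfl) (fun _ _ _ => rfl) fun i j t => ?_
  obtain rfl | hij := eq_or_ne i j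
  · exact ⟨t, fun _ _ => (substitute_self i _).symm⟩
  · let diag : (langCA n).Term Unit := Constants.term (L := langCA n) (CAFunc.diag i j)
    exact ⟨Functions.apply₁ (L := langCA n) (CAFunc.cyl i)
        (Functions.apply₂ (L := langCA n) CAFunc.inf diag t),
      fun _ _ => (substitute_eq_cylindrify hij _).symm⟩

namespace TermDefinable

variable {φ ψ χ : (U : Type u) → Set (Fin n → U) → (Fin n → U) → Prop}

theorem congr (hφ : TermDefinable φ) (h : ∀ U R s, φ U R s ↔ ψ U R s) : TermDefinable ψ := by
  obtain rfl : φ = ψ := by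
    funext U R s
    exact propext (h U R s)
  exact hφ

theorem or (hφ : TermDefinable φ) (hψ : TermDefinable ψ) :
    TermDefinable fun U R s => φ U R s ∨ ψ U R s :=
  (hφ.not.and hψ.not).not.congr fun _ _ _ => by tauto

theorem iff (hφ : TermDefinable φ) (hψ : TermDefinable ψ) :
    TermDefinable fun U R s => φ U R s ↔ ψ U R s :=
  ((hφ.and hψ).or (hφ.not.and hψ.not)).congr fun _ _ _ => by tauto

open scoped Classical in
theorem ite (hφ : TermDefinable φ) (hψ : TermDefinable ψ) (hχ : TermDefinable χ) :
    TermDefinable fun U R s => if φ U R s then ψ U R s else χ U R s :=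
  ((hφ.and hψ).or (hφ.not.and hχ)).congr fun U R s => by
    by_cases h : φ U R s <;> simp only [h, if_true, if_false] <;> tauto

theorem exists_eq_off (hφ : TermDefinable φ) (Γ : Finset (Fin n)) :
    TermDefinable fun U R s => ∃ t, φ U R t ∧ ∀ j ∉ Γ, t j = s j := by
  induction Γ using Finset.induction_on with
  | empty =>
    refine hφ.congr fun U R s => ⟨fun hs => ⟨s, hs, fun _ _ => rfl⟩, ?_⟩
    rintro ⟨t, ht, hts⟩
    rwa [← funext fun j => hts j (Finset.notMem_empty j)]
  | insert i Γ _ ih =>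
    refine (ih.exists_update i).congr fun U R s => ⟨?_, ?_⟩
    · rintro ⟨a, t, ht, hts⟩
      refine ⟨t, ht, fun j hj => ?_⟩
      rw [Finset.mem_insert, not_or] at hj
      rw [hts j hj.2, update_of_ne hj.1]
    · rintro ⟨t, ht, hts⟩
      refine ⟨t i, t, ht, fun j hj => ?_⟩
      obtain rfl | hji := eq_or_ne j i
      · rw [update_self]
      · rw [update_of_ne hji]
        exact hts j (Finset.mem_insert.not.2 (not_or.2 ⟨hji, hj⟩))

theorem exists_eq_on (hφ : TermDefinable φ) (Γ : Finset (Fin n)) :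
    TermDefinable fun U R s => ∃ t, φ U R t ∧ ∀ j ∈ Γ, t j = s j :=
  (hφ.exists_eq_off Γᶜ).congr fun _ _ _ => by simp only [Finset.mem_compl, not_not]

theorem forall_tuple (hφ : TermDefinable φ) : TermDefinable fun U R _ => ∀ t, φ U R t :=
  (hφ.not.exists_eq_on ∅).not.congr fun _ _ _ => by simp

theorem setOf_eq_setOf (hφ : TermDefinable φ) (hψ : TermDefinable ψ) :
    TermDefinable fun U R _ => {t | φ U R t} = {t | ψ U R t} :=
  (hφ.iff hψ).forall_tuple.congr fun _ _ _ => Set.ext_iff.symm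

end TermDefinable

/-- Definability of a set of elements of the base, by formulas in any one of the variables. -/
def DefinableSet (A : (U : Type u) → Set (Fin n → U) → Set U) : Prop :=
  ∀ i, TermDefinable fun U R s => s i ∈ A U R

/-- Definability of a binary relation on the base, by formulas in any two of the variables. -/
def DefinableRel (S : (U : Type u) → Set (Fin n → U) → SetRel U U) : Prop :=
  ∀ i j, TermDefinable fun U R s => s i ~[S U R] s j

namespace DefinableSet

variable {A B : (U : Type u) → Set (Fin n → U) → Set U}

theorem of_coord {i : Fin n} (h : TermDefinable fun U R s => s i ∈ A U R) : DefinableSet A :=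
  fun j => (h.subst i j).congr fun U R s => by rw [update_self]

theorem eq [Nonempty (Fin n)] (hA : DefinableSet A) (hB : DefinableSet B) :
    TermDefinable fun U R _ => A U R = B U R := by
  obtain ⟨i⟩ := ‹Nonempty (Fin n)›
  exact ((hA i).iff (hB i)).forall_tuple.congr fun _ _ _ =>
    ⟨fun h => Set.ext fun x => h fun _ => x, fun h _ => h ▸ Iff.rfl⟩

end DefinableSet

namespace DefinableRel

variable {S T : (U : Type u) → Set (Fin n → U) → SetRel U U}
  {A : (U : Type u) → Set (Fin n → U) → Set U}

theorem of_coords (hn : 2 < n) {i j : Fin n} (hij : i ≠ j)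
    (h : TermDefinable fun U R s => s i ~[S U R] s j) : DefinableRel S := by
  have moveLeft {i j : Fin n} (hij : i ≠ j) (h : TermDefinable fun U R s => s i ~[S U R] s j)
      (k : Fin n) : TermDefinable fun U R s => s k ~[S U R] s j :=
    (h.subst i k).congr fun U R s => by rw [update_self, update_of_ne hij.symm]
  have moveRight {i j : Fin n} (hij : i ≠ j) (h : TermDefinable fun U R s => s i ~[S U R] s j)
      (k : Fin n) : TermDefinable fun U R s => s i ~[S U R] s k :=
    (h.subst j k).congr fun U R s => by rw [update_self, update_of_ne hij]
  intro k l
  obtain rfl | hkj := eq_or_ne k j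
  · obtain ⟨m, hmi, hmk⟩ := Fin.exists_ne_and_ne_of_two_lt i k hn
    exact moveRight hmk.symm (moveLeft hmi.symm (moveRight hij h m) k) l
  · exact moveRight hkj (moveLeft hij h k) l

theorem inv (hS : DefinableRel S) : DefinableRel fun U R => (S U R).inv :=
  fun i j => hS j i

theorem comp (hn : 2 < n) (hS : DefinableRel S) (hT : DefinableRel T) :
    DefinableRel fun U R => S U R ○ T U R := by
  intro i j
  obtain ⟨k, hki, hkj⟩ := Fin.exists_ne_and_ne_of_two_lt i j hn
  exact (((hS i k).and (hT k j)).exists_update k).congr fun U R s => by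
    simp only [update_self, update_of_ne hki.symm, update_of_ne hkj.symm, SetRel.mem_comp]

theorem image [Nontrivial (Fin n)] (hS : DefinableRel S) (hA : DefinableSet A) :
    DefinableSet fun U R => (S U R).image (A U R) := by
  intro j
  obtain ⟨i, hij⟩ := exists_ne j
  exact (((hA i).and (hS i j)).exists_update i).congr fun U R s => by
    simp only [update_self, update_of_ne hij.symm, SetRel.mem_image]

theorem preimage [Nontrivial (Fin n)] (hS : DefinableRel S) (hA : DefinableSet A) :
    DefinableSet fun U R => (S U R).preimage (A U R) :=
  hS.inv.image hA

theorem eq [Nontrivial (Fin n)] (hS : DefinableRel S) (hT : DefinableRel T) :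
    TermDefinable fun U R _ => S U R = T U R := by
  obtain ⟨i, j, hij⟩ := exists_pair_ne (Fin n)
  refine ((hS i j).iff (hT i j)).forall_tuple.congr fun U R _ =>
    ⟨fun h => Set.ext fun ⟨x, y⟩ => ?_, fun h _ => h ▸ Iff.rfl⟩
  simpa [update_of_ne hij.symm] using h (update (fun _ => y) i x)

end DefinableRel

end Definable

/-! ### Marked graphs coded by relations -/

section MarkedGraph

variable {n : ℕ} {U : Type u} (e : Fin 3 ↪ Fin n) {R : Set (Fin n → U)} {S : SetRel U U}
  {A : Set U}

/-- The `n`-ary relation coding a graph `S` with a set `A` of marked vertices; `e` selects the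
three coordinates used by the code. -/
def ofMarkedGraph (S : SetRel U U) (A : Set U) : Set (Fin n → U) :=
  {s | s (e 0) ~[S] s (e 1) ∧ s (e 2) ∈ A}

/-- The graph coded by an `n`-ary relation. -/
def edges (R : Set (Fin n → U)) : SetRel U U := (fun s => (s (e 0), s (e 1))) '' R

/-- The set of marked vertices coded by an `n`-ary relation. -/
def marks (R : Set (Fin n → U)) : Set U := (fun s => s (e 2)) '' R

theorem exists_tuple_apply_eq (x : Fin 3 → U) : ∃ s : Fin n → U, ∀ i, s (e i) = x i :=
  ⟨extend e x fun _ => x 0, e.injective.extend_apply x _⟩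

theorem edges_ofMarkedGraph (hA : S.Nonempty → A.Nonempty) :
    edges e (ofMarkedGraph e S A) = S := by
  refine Set.Subset.antisymm (Set.image_subset_iff.2 fun s hs => hs.1) ?_
  rintro ⟨x, y⟩ hxy
  obtain ⟨z, hz⟩ := hA ⟨_, hxy⟩
  obtain ⟨s, hs⟩ := exists_tuple_apply_eq e ![x, y, z]
  exact ⟨s, by simp_all [ofMarkedGraph], by simp [hs]⟩

theorem marks_ofMarkedGraph (hS : A.Nonempty → S.Nonempty) :
    marks e (ofMarkedGraph e S A) = A := by
  refine Set.Subset.antisymm (Set.image_subset_iff.2 fun s hs => hs.2) ?_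
  rintro z hz
  obtain ⟨⟨x, y⟩, hxy⟩ := hS ⟨z, hz⟩
  obtain ⟨s, hs⟩ := exists_tuple_apply_eq e ![x, y, z]
  exact ⟨s, by simp_all [ofMarkedGraph], by simp [hs]⟩

/-- The relation codes a marked graph in which the set of marks can be recovered from its image
under the graph, and so can this image from its own image. -/
structure IsShiftable (R : Set (Fin n → U)) : Prop where
  ofMarkedGraph_eq : ofMarkedGraph e (edges e R) (marks e R) = R
  preimage_image : (edges e R).preimage ((edges e R).image (marks e R)) = marks e R
  comp_comp_inv : edges e R ○ edges e R ○ (edges e R).inv = edges e R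

/-- Move the marks forward along the edges. -/
def shift (R : Set (Fin n → U)) : Set (Fin n → U) :=
  ofMarkedGraph e (edges e R) ((edges e R).image (marks e R))

/-- Move the marks backward along the edges. -/
def unshift (R : Set (Fin n → U)) : Set (Fin n → U) :=
  ofMarkedGraph e (edges e R) ((edges e R).preimage (marks e R))

theorem marks_shift (R : Set (Fin n → U)) :
    marks e (shift e R) = (edges e R).image (marks e R) :=
  marks_ofMarkedGraph e fun ⟨_, _, _, h⟩ => ⟨_, h⟩

variable {e}

theorem isShiftable_ofMarkedGraph (hS : S.Nonempty) (hA : A.Nonempty)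
    (h : S.preimage (S.image A) = A) (hSSS : S ○ S ○ S.inv = S) :
    IsShiftable e (ofMarkedGraph e S A) := by
  have edges_eq := edges_ofMarkedGraph e fun _ : S.Nonempty => hA
  have marks_eq := marks_ofMarkedGraph e fun _ : A.Nonempty => hS
  constructor <;> simp only [edges_eq, marks_eq, h, hSSS]

namespace IsShiftable

theorem edges_shift (h : IsShiftable e R) : edges e (shift e R) = edges e R := by
  refine edges_ofMarkedGraph e fun hS => ?_
  have marks_nonempty : (marks e R).Nonempty := hS.of_image.image _
  rw [← h.preimage_image] at marks_nonempty
  obtain ⟨_, y, hy, -⟩ := marks_nonempty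
  exact ⟨y, hy⟩

theorem preimage_image_image (h : IsShiftable e R) :
    (edges e R).preimage ((edges e R).image ((edges e R).image (marks e R))) =
      (edges e R).image (marks e R) := by
  conv_rhs => rw [← h.comp_comp_inv, SetRel.image_comp, SetRel.image_comp, SetRel.image_inv]

protected theorem shift (h : IsShiftable e R) : IsShiftable e (shift e R) where
  ofMarkedGraph_eq := by rw [h.edges_shift, marks_shift, CylindricLike.shift]
  preimage_image := by rw [h.edges_shift, marks_shift, h.preimage_image_image]
  comp_comp_inv := by rw [h.edges_shift, h.comp_comp_inv]

theorem unshift_shift (h : IsShiftable e R) : unshift e (CylindricLike.shift e R) = R := by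
  rw [unshift, h.edges_shift, marks_shift, h.preimage_image, h.ofMarkedGraph_eq]

end IsShiftable

variable (e)

open scoped Classical in
/-- The operation `shift` on shiftable relations, and the identity elsewhere. -/
noncomputable def condShift (R : Set (Fin n → U)) : Set (Fin n → U) :=
  if IsShiftable e R then shift e R else R

open scoped Classical in
/-- The operation `unshift` on shiftable relations, and the identity elsewhere. -/
noncomputable def condUnshift (R : Set (Fin n → U)) : Set (Fin n → U) :=
  if IsShiftable e R then unshift e R else R

theorem leftInverse_condUnshift_condShift :
    LeftInverse (condUnshift e : Set (Fin n → U) → Set (Fin n → U)) (condShift e) := by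
  intro R
  by_cases h : IsShiftable e R
  · rw [condShift, if_pos h, condUnshift, if_pos h.shift, h.unshift_shift]
  · rw [condShift, if_neg h, condUnshift, if_neg h]

theorem marks_subset_cod_edges_of_condShift_eq {Q : Set (Fin n → U)} (hQ : IsShiftable e Q)
    (h : condShift e R = Q) : marks e Q ⊆ (edges e Q).cod := by
  by_cases hR : IsShiftable e R
  · rw [condShift, if_pos hR] at h
    rw [← h, marks_shift, hR.edges_shift]
    exact fun y ⟨x, _, hxy⟩ => ⟨x, hxy⟩
  · rw [condShift, if_neg hR] at h
    exact absurd (h ▸ hQ) hR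

theorem not_surjective_condShift :
    ¬ Surjective (condShift e : Set (Fin n → ULift.{u} ℕ) → Set (Fin n → ULift.{u} ℕ)) := by
  let S : SetRel (ULift.{u} ℕ) (ULift.{u} ℕ) := {p | p.2.down = p.1.down + 1}
  let A : Set (ULift.{u} ℕ) := {⟨0⟩}
  have hS : S.Nonempty := ⟨(⟨0⟩, ⟨1⟩), rfl⟩
  have hA : A.Nonempty := Set.singleton_nonempty _
  have preimage_image : S.preimage (S.image A) = A := by
    ext ⟨x⟩
    simp [S, A]
  have comp_comp_inv : S ○ S ○ S.inv = S := by
    ext ⟨⟨x⟩, ⟨y⟩⟩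
    simp [S, eq_comm]
  intro hsurj
  obtain ⟨R, hR⟩ := hsurj (ofMarkedGraph e S A)
  have marks_subset := marks_subset_cod_edges_of_condShift_eq e
    (isShiftable_ofMarkedGraph hS hA preimage_image comp_comp_inv) hR
  rw [marks_ofMarkedGraph e fun _ => hS, edges_ofMarkedGraph e fun _ => hA] at marks_subset
  obtain ⟨x, hx⟩ := marks_subset (Set.mem_singleton _)
  exact Nat.succ_ne_zero _ hx.symm

end MarkedGraph

section ShiftDefinable

variable {n : ℕ} (e : Fin 3 ↪ Fin n)

theorem two_lt_of_embedding (e : Fin 3 ↪ Fin n) : 2 < n :=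
  Nat.lt_of_succ_le (by simpa using Fintype.card_le_of_embedding e)

theorem definableRel_edges : DefinableRel.{u} fun _ R => edges e R :=
  .of_coords (two_lt_of_embedding e) (e.injective.ne zero_ne_one) <|
    (TermDefinable.mem.exists_eq_on {e 0, e 1}).congr fun _ _ _ => by
      simp [edges]

theorem definableSet_marks : DefinableSet.{u} fun _ R => marks e R :=
  .of_coord (i := e 2) <| (TermDefinable.mem.exists_eq_on {e 2}).congr fun _ _ _ => by
    simp [marks]

theorem termDefinable_ofMarkedGraph {S : (U : Type u) → Set (Fin n → U) → SetRel U U}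
    {A : (U : Type u) → Set (Fin n → U) → Set U} (hS : DefinableRel S) (hA : DefinableSet A) :
    TermDefinable fun U R s => s ∈ ofMarkedGraph e (S U R) (A U R) :=
  (hS (e 0) (e 1)).and (hA (e 2))

theorem termDefinable_isShiftable : TermDefinable.{u} fun _ R _ => IsShiftable e R := by
  have : Nontrivial (Fin n) := e.injective.nontrivial
  have hn := two_lt_of_embedding e
  have hS := definableRel_edges.{u} e
  have hA := definableSet_marks.{u} e
  have isCode := (termDefinable_ofMarkedGraph e hS hA).setOf_eq_setOf .mem
  have preimage_image := (hS.preimage (hS.image hA)).eq hA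
  have comp_comp_inv := ((hS.comp hn hS).comp hn hS.inv).eq hS
  exact (isCode.and (preimage_image.and comp_comp_inv)).congr fun _ _ _ =>
    ⟨fun ⟨h₁, h₂, h₃⟩ => ⟨h₁, h₂, h₃⟩, fun ⟨h₁, h₂, h₃⟩ => ⟨h₁, h₂, h₃⟩⟩

theorem termDefinable_condShift : TermDefinable.{u} fun _ R s => s ∈ condShift e R := by
  have : Nontrivial (Fin n) := e.injective.nontrivial
  have hS := definableRel_edges.{u} e
  have shifted := termDefinable_ofMarkedGraph e hS (hS.image (definableSet_marks e))
  exact ((termDefinable_isShiftable e).ite shifted .mem).congr fun U R s => by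
    unfold condShift; split_ifs <;> rfl

theorem termDefinable_condUnshift : TermDefinable.{u} fun _ R s => s ∈ condUnshift e R := by
  have : Nontrivial (Fin n) := e.injective.nontrivial
  have hS := definableRel_edges.{u} e
  have unshifted := termDefinable_ofMarkedGraph e hS (hS.preimage (definableSet_marks e))
  exact ((termDefinable_isShiftable e).ite unshifted .mem).congr fun U R s => by
    unfold condUnshift; split_ifs <;> rfl

theorem ExpressesDefinable.exists_irredundantlyGenerates_not_freelyGenerates
    {L : FirstOrder.Language.{0, 0}} [∀ U : Type u, L.Structure (Set (Fin n → U))]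
    (hL : ExpressesDefinable.{u} L n) (e : Fin 3 ↪ Fin n) (X : Type u) [Nonempty X] :
    ∃ Y : Set (FreeAlg (SP L fun U : Type u => Set (Fin n → U)) X),
      #Y = #X ∧ IrredundantlyGenerates L Y ∧
        ¬ FreelyGenerates (SP L fun U : Type u => Set (Fin n → U)) Y := by
  obtain ⟨τ, hτ⟩ := hL _ (termDefinable_condShift e)
  obtain ⟨σ, hσ⟩ := hL _ (termDefinable_condUnshift e)
  have τ_eq (U : Type u) : (termOp τ : Set (Fin n → U) → _) = condShift e := funext (hτ U)
  have σ_eq (U : Type u) : (termOp σ : Set (Fin n → U) → _) = condUnshift e := funext (hσ U)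
  refine CylindricLike.exists_irredundantlyGenerates_not_freelyGenerates (σ := σ) (τ := τ)
    (fun A _ hA => ?_) (SP_self L _ (ULift.{u} ℕ)) ?_
  · refine leftInverse_termOp_iff.2 (hA.realize_eq_realize fun U => leftInverse_termOp_iff.1 ?_)
    rw [σ_eq, τ_eq]
    exact leftInverse_condUnshift_condShift e
  · rw [τ_eq]
    exact not_surjective_condShift e

end ShiftDefinable

end CylindricLike

theorem mainTheorem1 (n : ℕ) (hn : 2 < n) (β : Cardinal.{u}) (hβ : 0 < β) :
    (∃ Y : Set (CylindricLike.Fr (CylindricLike.RCA.{u} n) β),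
      Cardinal.mk Y = β ∧
      CylindricLike.IrredundantlyGenerates (CylindricLike.langCA n) Y ∧
      ¬ CylindricLike.FreelyGenerates (CylindricLike.RCA.{u} n) Y) ∧
    (∃ Y : Set (CylindricLike.Fr (CylindricLike.RSC.{u} n) β),
      Cardinal.mk Y = β ∧
      CylindricLike.IrredundantlyGenerates (CylindricLike.langSC n) Y ∧
      ¬ CylindricLike.FreelyGenerates (CylindricLike.RSC.{u} n) Y) := by
  have : Nonempty β.out := Cardinal.mk_ne_zero_iff.1 (β.mk_out.trans_ne hβ.ne')
  have hCA :=
    CylindricLike.ExpressesDefinable.exists_irredundantlyGenerates_not_freelyGenerates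
      (CylindricLike.expressesDefinable_langCA.{u} n) (Fin.castLEEmb hn) β.out
  have hSC :=
    CylindricLike.ExpressesDefinable.exists_irredundantlyGenerates_not_freelyGenerates
      (CylindricLike.expressesDefinable_langSC.{u} n) (Fin.castLEEmb hn) β.out
  rw [β.mk_out] at hCA hSC
  exact ⟨hCA, hSC⟩
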